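/- Let $\mathcal P_{\mathbb Q}$ be the class of finite-dimensional vector spaces over $\mathbb Q$ equipped with a $\mathbb Q$-valued polyhedral norm, that is, a norm of the form $\|x\|=\max_{1\le i\le n}|u_i(x)|$ for finitely many linear functionals $u_1,\dots,u_n$ with values in $\mathbb Q$. These spaces are regarded as structures whose functions are the rational linear combinations (including the constant $0$) and whose relations are the unary predicates "$\|x\|=q$", $q\in\mathbb Q$, so that embeddings are the linear isometric injections. The rational Gurarii space $\mathbb G_{\mathbb Q}$ is the Fraïssé limit of $\mathcal P_{\mathbb Q}$, which is a countable normed space over $\mathbb Q$ (unique up to linear isometry). The Gurarii space $\mathbb G$ is the (unique up to linear isometry) separable real Banach space such that for all $\varepsilon>0$, all finite-dimensional real normed spaces $E\subseteq F$ and every linear isometric embedding $\varphi:E\to\mathbb G$ there is an injective linear map $\Phi:F\to\mathbb G$ that extends $\varphi$ and satisfies $(1-\varepsilon)\|x\|<\|\Phi(x)\|<(1+\varepsilon)\|x\|$ for all $x\in F\setminus\{0\}$. **Proposition.** The completion of the rational Gurarii space $\mathbb G_{\mathbb Q}$, with the real scalar multiplication that extends the rational one by continuity, is the Gurarii space $\mathbb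 G$: it is a separable Banach space with the extension property above, and every separable Banach space with this property is linearly isometric to it. -/

import Mathlib

open UniformSpace

universe u v

namespace RationalGurarii

/-! ### The real vector space structure on the completion of a normed space over `ℚ` -/

section Completion

theorem isDenseInducing_toCompl (V : Type*) [NormedAddCommGroup V] :
    IsDenseInducing (Completion.toCompl : V →+ Completion V) :=
  Completion.isDenseInducing_coe

variable (V : Type*) [NormedAddCommGroup V] [NormedSpace ℚ V]

/-- The map `(q, x) ↦ q • x` from `ℚ × V` to the completion of `V`, as a biadditive map. -/
noncomputable def ratSMulHom : ℚ →+ V →+ Completion V :=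
  AddMonoidHom.mk' (fun q => Completion.toCompl.comp (DistribSMul.toAddMonoidHom V q)) (by
    intro p q
    ext x
    exact (congrArg _ (add_smul p q x)).trans (Completion.coe_add _ _))

theorem continuous_ratSMulHom : Continuous fun p : ℚ × V => ratSMulHom V p.1 p.2 :=
  (Completion.continuous_coe V).comp continuous_smul

theorem isDenseInducing_coeRat : IsDenseInducing ((Rat.castHom ℝ).toAddMonoidHom) :=
  Rat.isDenseEmbedding_coe_real.isDenseInducing

/-- Multiplication by real scalars on the completion of a normed space over `ℚ`: the continuous
extension of `(q, x) ↦ q • x`. -/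
noncomputable def realSMul (r : ℝ) (x : Completion V) : Completion V :=
  (isDenseInducing_coeRat.prodMap (isDenseInducing_toCompl V)).extend
    (fun p : ℚ × V => ratSMulHom V p.1 p.2) (r, x)

theorem continuous_realSMul : Continuous fun p : ℝ × Completion V => realSMul V p.1 p.2 :=
  IsDenseInducing.extend_Z_bilin (φ := ratSMulHom V) isDenseInducing_coeRat
    (isDenseInducing_toCompl V) (continuous_ratSMulHom V)

theorem realSMul_coe (q : ℚ) (x : V) :
    realSMul V (q : ℝ) (x : Completion V) = ((q • x : V) : Completion V) :=
  (isDenseInducing_coeRat.prodMap (isDenseInducing_toCompl V)).extend_eq (continuous_ratSMulHom V) (q, x)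

variable {V}

theorem realSMul_cont {X : Type*} [TopologicalSpace X] {f : X → ℝ} {g : X → Completion V}
    (hf : Continuous f) (hg : Continuous g) :
    Continuous fun x => realSMul V (f x) (g x) :=
  (continuous_realSMul V).comp (hf.prodMk hg)

theorem real_induction {p : ℝ → Prop} (hp : IsClosed {r | p r}) (h : ∀ q : ℚ, p q) (r : ℝ) : p r :=
  Rat.isDenseEmbedding_coe_real.dense.induction_on r hp h

/-- The completion of a normed space over `ℚ` is a normed space over `ℝ`. -/
noncomputable instance completionNormedSpace : NormedSpace ℝ (Completion V) where
  smul r x := realSMul V r x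
  one_smul x := by
    change realSMul V 1 x = x
    induction x using Completion.induction_on with
    | hp => exact isClosed_eq (realSMul_cont continuous_const continuous_id) continuous_id
    | ih x => simpa using realSMul_coe V 1 x
  mul_smul r s x := by
    change realSMul V (r * s) x = realSMul V r (realSMul V s x)
    induction x using Completion.induction_on with
    | hp =>
      exact isClosed_eq (realSMul_cont continuous_const continuous_id)
        (realSMul_cont continuous_const (realSMul_cont continuous_const continuous_id))
    | ih x =>
      induction r using real_induction with
      | hp =>
        exact isClosed_eq (realSMul_cont (continuous_id.mul continuous_const) continuous_const)
          (realSMul_cont continuous_id continuous_const)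
      | h r =>
        induction s using real_induction with
        | hp =>
          exact isClosed_eq
            (realSMul_cont (continuous_const.mul continuous_id) continuous_const)
            (realSMul_cont continuous_const (realSMul_cont continuous_id continuous_const))
        | h s => rw [← Rat.cast_mul, realSMul_coe, realSMul_coe, realSMul_coe, mul_smul]
  smul_zero r := by
    change realSMul V r 0 = 0
    induction r using real_induction with
    | hp => exact isClosed_eq (realSMul_cont continuous_id continuous_const) continuous_const
    | h r => rw [← Completion.coe_zero, realSMul_coe, smul_zero]
  smul_add r x y := by
    change realSMul V r (x + y) = realSMul V r x + realSMul V r y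
    induction x, y using Completion.induction_on₂ with
    | hp =>
      exact isClosed_eq (realSMul_cont continuous_const (continuous_fst.add continuous_snd))
        ((realSMul_cont continuous_const continuous_fst).add
          (realSMul_cont continuous_const continuous_snd))
    | ih x y =>
      induction r using real_induction with
      | hp =>
        refine isClosed_eq (realSMul_cont continuous_id continuous_const) (Continuous.add ?_ ?_)
        · exact realSMul_cont continuous_id continuous_const
        · exact realSMul_cont continuous_id continuous_const
      | h r =>
        rw [← Completion.coe_add, realSMul_coe, realSMul_coe, realSMul_coe, smul_add,
          Completion.coe_add]
  add_smul r s x := by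
    change realSMul V (r + s) x = realSMul V r x + realSMul V s x
    induction x using Completion.induction_on with
    | hp =>
      exact isClosed_eq (realSMul_cont continuous_const continuous_id)
        ((realSMul_cont continuous_const continuous_id).add
          (realSMul_cont continuous_const continuous_id))
    | ih x =>
      induction r using real_induction with
      | hp =>
        refine isClosed_eq (realSMul_cont (continuous_id.add continuous_const) continuous_const)
          (Continuous.add ?_ continuous_const)
        exact realSMul_cont continuous_id continuous_const
      | h r =>
        induction s using real_induction with
        | hp =>
          exact isClosed_eq
            (realSMul_cont (continuous_const.add continuous_id) continuous_const)
            (continuous_const.add (realSMul_cont continuous_id continuous_const))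
        | h s =>
          rw [← Rat.cast_add, realSMul_coe, realSMul_coe, realSMul_coe, add_smul,
            Completion.coe_add]
  zero_smul x := by
    change realSMul V 0 x = 0
    induction x using Completion.induction_on with
    | hp => exact isClosed_eq (realSMul_cont continuous_const continuous_id) continuous_const
    | ih x => simpa [Completion.coe_zero] using realSMul_coe V 0 x
  norm_smul_le r x := by
    change ‖realSMul V r x‖ ≤ ‖r‖ * ‖x‖
    induction x using Completion.induction_on with
    | hp =>
      exact isClosed_le (realSMul_cont continuous_const continuous_id).norm
        (continuous_const.mul continuous_norm)
    | ih x =>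
      induction r using real_induction with
      | hp =>
        exact isClosed_le (realSMul_cont continuous_id continuous_const).norm
          (continuous_norm.mul continuous_const)
      | h r =>
        rw [realSMul_coe, Completion.norm_coe, Completion.norm_coe, norm_smul]
        exact le_of_eq rfl

/-- The real scalar multiplication on the completion extends the rational one on `V`. -/
theorem ratCast_smul_coe (q : ℚ) (x : V) :
    (q : ℝ) • (x : Completion V) = ((q • x : V) : Completion V) :=
  realSMul_coe V q x

end Completion

/-! ### Rational polyhedral spaces and the rational Gurarii space -/

/-- The relation symbols of the signature of rational normed spaces: for each `q : ℚ` a unary symbol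
expressing that a vector has norm `q`. -/
inductive NormRel : ℕ → Type
  | normEq (q : ℚ) : NormRel 1

/-- The signature of rational normed spaces: for all `n` and `a₁, …, aₙ ∈ ℚ` an `n`-ary function
symbol for the linear combination with coefficients `a₁, …, aₙ` (the case `n = 0` being the constant
symbol for the zero vector), and for each `q ∈ ℚ` a unary relation symbol for `‖x‖ = q`. -/
def normLang : FirstOrder.Language.{0, 0} where
  Functions n := Fin n → ℚ
  Relations := NormRel

instance : Countable (Σ n, normLang.Functions n) :=
  inferInstanceAs (Countable (Σ n : ℕ, (Fin n → ℚ)))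

/-- A normed space over `ℚ`, regarded as a structure in the signature of rational normed spaces. -/
@[reducible] def normStructure (V : Type*) [NormedAddCommGroup V] [NormedSpace ℚ V] :
    normLang.Structure V where
  funMap {n} (a : Fin n → ℚ) x := ∑ i, a i • x i
  RelMap {_} r x := match r with
    | NormRel.normEq q => ‖x 0‖ = (q : ℝ)

/-- A norm on a vector space over `ℚ` is polyhedral if it is the maximum of the absolute values of
finitely many linear functionals with values in `ℚ`. -/
def IsPolyhedral (V : Type*) [NormedAddCommGroup V] [NormedSpace ℚ V] : Prop :=
  ∃ (n : ℕ) (f : Fin n → (V →ₗ[ℚ] ℚ)),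
    ∀ x : V, IsGreatest (Set.range fun i => ((|f i x| : ℚ) : ℝ)) ‖x‖

/-- The class of finite-dimensional vector spaces over `ℚ` with a polyhedral norm taking values
in `ℚ`, as a class of structures in the signature of rational normed spaces. -/
def polyhedralClass : Set (CategoryTheory.Bundled.{u} normLang.Structure) :=
  {M | ∃ (_ : NormedAddCommGroup M) (_ : NormedSpace ℚ M),
    M.str = normStructure M ∧ FiniteDimensional ℚ M ∧
      (∀ x : M, ∃ q : ℚ, ‖x‖ = (q : ℝ)) ∧ IsPolyhedral M}

/-- `V` is (a model of) the rational Gurarii space: it is a countable vector space over `ℚ` with a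
norm taking values in `ℚ` and it is the Fraïssé limit of the class of finite-dimensional vector
spaces over `ℚ` with a polyhedral norm taking values in `ℚ`. -/
structure IsRationalGurarii (V : Type u) [NormedAddCommGroup V] [NormedSpace ℚ V] : Prop where
  countable : Countable V
  norm_rational : ∀ x : V, ∃ q : ℚ, ‖x‖ = (q : ℝ)
  isFraisseLimit :
    letI := normStructure V
    FirstOrder.Language.IsFraisseLimit polyhedralClass.{u} V

/-! ### The Gurarii space -/

/-- `G` is (a model of) the Gurarii space: it is a separable Banach space over `ℝ` such that for all
`ε > 0`, all finite-dimensional normed spaces `E ⊆ F` and every isometric embedding `φ : E → G` there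
is a linear embedding `Φ : F → G` extending `φ` with `(1 - ε) ‖x‖ < ‖Φ x‖ < (1 + ε) ‖x‖` for all
`x ≠ 0` in `F`. (Every finite-dimensional real space is isometric to one whose underlying type lies
in the lowest universe, so that `F : Type` is no restriction.) -/
structure IsGurarii (G : Type*) [NormedAddCommGroup G] [NormedSpace ℝ G] : Prop where
  complete : CompleteSpace G
  separable : TopologicalSpace.SeparableSpace G
  extension : ∀ ε : ℝ, 0 < ε →
    ∀ (F : Type) [NormedAddCommGroup F] [NormedSpace ℝ F] [FiniteDimensional ℝ F]
      (E : Submodule ℝ F) (φ : E →ₗᵢ[ℝ] G),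
      ∃ Φ : F →ₗ[ℝ] G, Function.Injective Φ ∧ (∀ x : E, Φ x = φ x) ∧
        ∀ x : F, x ≠ 0 → (1 - ε) * ‖x‖ < ‖Φ x‖ ∧ ‖Φ x‖ < (1 + ε) * ‖x‖

end RationalGurarii

/-! Extension property: approximate the images of a basis of `E` by vectors `v i` of `V`. Finitely
generated substructures of a Fraïssé limit lie in the class, so the norm on the rational span of the
`v i` is a maximum of finitely many rational functionals. Pulled back to `E`, these extend by
Hahn–Banach to `F` with norm barely above 1, and are rounded to rational values on a basis. Adding
finitely many rational functionals of norm slightly below 1 that almost norm `F` gives a rational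
polyhedral norm close to that of `F`, without changing it on the part coming from `E`.
Ultrahomogeneity realises this norm in `V` (`IsRationalGurarii.exists_almost_isometric_extension`);
real-linear extension and a small correction on the basis of `E` finish the argument
(`IsRationalGurarii.completion_extension`).

Uniqueness: for an `ε`-isometric map `f` from `E` into `F`, glue `E` and `F` into one normed space
in which `x` and `f x` are at most `ε * ‖x‖` apart (`amalgamSeminorm`). Extending the inclusion of
`E` to this space gives an approximate inverse of `f` whose own distortion is as small as desired
(`IsGurarii.exists_almost_inverse`). Alternating sides with distortions `(1 / 2) ^ n` gives maps
that converge on a dense subspace to an isometry with dense range. -/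

namespace RationalGurarii

open FirstOrder FirstOrder.Language

/-! ### Model theory of the Fraïssé limit in terms of linear isometric maps -/

section ModelTheory

/-- A linear isometric map between normed spaces over `ℚ`, as an embedding of structures. -/
def normEmbedding {V W : Type*} [NormedAddCommGroup V] [NormedSpace ℚ V]
    [NormedAddCommGroup W] [NormedSpace ℚ W] (f : V →ₗ[ℚ] W) (hf : ∀ x, ‖f x‖ = ‖x‖) :
    letI := normStructure V
    letI := normStructure W
    V ↪[normLang] W :=
  letI := normStructure V
  letI := normStructure W
  { toFun := f
    inj' := (injective_iff_map_eq_zero f).2 fun x hx => by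
      rw [← norm_eq_zero, ← hf, hx, norm_zero]
    map_fun' := by
      intro n (a : Fin n → ℚ) x
      change f (∑ i, a i • x i) = ∑ i, a i • f (x i)
      simp
    map_rel' := by
      rintro _ ⟨q⟩ x
      change ‖f (x 0)‖ = (q : ℝ) ↔ ‖x 0‖ = (q : ℝ)
      rw [hf] }

/-- Embeddings of rational normed spaces as structures are linear isometric maps. -/
theorem exists_linearMap_of_embedding {V W : Type*} [NormedAddCommGroup V] [NormedSpace ℚ V]
    [NormedAddCommGroup W] [NormedSpace ℚ W] (hV : ∀ x : V, ∃ q : ℚ, ‖x‖ = (q : ℝ))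
    (f : letI := normStructure V
      letI := normStructure W
      V ↪[normLang] W) :
    ∃ g : V →ₗ[ℚ] W, (∀ x, g x = f.toFun x) ∧ ∀ x, ‖g x‖ = ‖x‖ := by
  let := normStructure V
  let := normStructure W
  refine ⟨{ toFun := f.toFun, map_add' := fun x y => ?_, map_smul' := fun q x => ?_ },
    fun _ => rfl, fun x => ?_⟩
  · have h := f.map_fun' (n := 2) (fun _ => (1 : ℚ)) ![x, y]
    change f.toFun (∑ i, (1 : ℚ) • ![x, y] i) = ∑ i, (1 : ℚ) • f.toFun (![x, y] i) at h
    simpa [Fin.sum_univ_two] using h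
  · have h := f.map_fun' (n := 1) (fun _ => q) ![x]
    change f.toFun (∑ i, q • ![x] i) = ∑ i, q • f.toFun (![x] i) at h
    simpa using h
  -- The relations detect only rational norms, so rationality is needed in the source.
  · obtain ⟨q, hq⟩ := hV x
    have h := f.map_rel' (n := 1) (NormRel.normEq q) ![x]
    change ‖f.toFun x‖ = (q : ℝ) ↔ ‖x‖ = (q : ℝ) at h
    rw [hq]
    exact h.2 hq

variable {V : Type u} [NormedAddCommGroup V] [NormedSpace ℚ V]

/-- The norm of a finitely generated subspace of the rational Gurarii space is given by finitely
many rational functionals. -/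
theorem IsRationalGurarii.exists_polyhedral (hV : IsRationalGurarii V) {ι : Type*} [Fintype ι]
    (v : ι → V) :
    ∃ (n : ℕ) (T : (ι → ℚ) →ₗ[ℚ] (Fin n → ℚ)), 0 < n ∧ ∀ a, ‖T a‖ = ‖∑ i, a i • v i‖ := by
  let := normStructure V
  have := hV.countable
  let S : normLang.Substructure V := Substructure.closure normLang (Set.range v)
  have hS : S.FG := Substructure.fg_closure (Set.finite_range v)
  have hm := age.fg_substructure hS
  rw [hV.isFraisseLimit.age] at hm
  obtain ⟨i₁, i₂, hstr, -, hrat, n, f, hf⟩ := hm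
  change S.inducedStructure = normStructure S at hstr
  -- The norm on `S` supplied by the class is not given as the restriction of that of `V`. They
  -- agree because the inclusion is an embedding of structures.
  have he : ∃ e : @Language.Embedding normLang S V (normStructure S) _, ∀ x, e.toFun x = x := by
    rw [← hstr]
    exact ⟨S.subtype, fun _ => rfl⟩
  obtain ⟨e, he⟩ := he
  obtain ⟨g, hg, hgn⟩ := exists_linearMap_of_embedding (V := S) hrat e
  let m : ι → S := fun i => ⟨v i, Substructure.subset_closure ⟨i, rfl⟩⟩
  have hgm : ∀ i, g (m i) = v i := fun i => (hg _).trans (he _)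
  let T : (ι → ℚ) →ₗ[ℚ] (Fin n → ℚ) :=
    LinearMap.pi fun j => (f j).comp (Fintype.linearCombination ℚ m)
  have key : ∀ a, ‖T a‖ = ‖∑ i, a i • v i‖ := by
    intro a
    have h1 : ‖∑ i, a i • v i‖ = ‖∑ i, a i • m i‖ := by
      rw [← hgn, map_sum]
      simp_rw [map_smul, hgm]
    rw [h1]
    have h2 := hf (∑ i, a i • m i)
    have h3 : ∀ j, ‖T a j‖ = ((|f j (∑ i, a i • m i)| : ℚ) : ℝ) := by
      intro j
      rw [← Rat.norm_cast_real, Real.norm_eq_abs, Rat.cast_abs]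
      rfl
    apply le_antisymm
    · refine (pi_norm_le_iff_of_nonneg (norm_nonneg _)).2 fun j => ?_
      rw [h3]
      exact h2.2 ⟨j, rfl⟩
    · obtain ⟨j, hj⟩ := h2.1
      rw [← hj]
      dsimp only
      rw [← h3]
      exact norm_le_pi_norm _ _
  refine ⟨n, T, ?_, key⟩
  obtain ⟨j, -⟩ := (hf 0).1
  exact j.pos

/-- The maximum norm of a rational vector is attained at some coordinate. -/
theorem exists_norm_eq_abs_apply {κ : Type*} [Fintype κ] [Nonempty κ] (x : κ → ℚ) :
    ∃ i, ‖x‖ = ((|x i| : ℚ) : ℝ) := by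
  obtain ⟨i, hi⟩ := Finite.exists_max fun i => ‖x i‖
  refine ⟨i, ?_⟩
  rw [Rat.cast_abs, ← Real.norm_eq_abs, Rat.norm_cast_real]
  exact le_antisymm ((pi_norm_le_iff_of_nonneg (norm_nonneg _)).2 hi) (norm_le_pi_norm _ _)

/-- A subspace of a finite power of `ℚ` with the maximum norm belongs to the class of rational
polyhedral spaces. -/
theorem mem_polyhedralClass_submodule {κ : Type u} [Fintype κ] [Nonempty κ]
    (S : Submodule ℚ (κ → ℚ)) :
    (⟨S, normStructure S⟩ : CategoryTheory.Bundled normLang.Structure) ∈ polyhedralClass.{u} := by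
  refine ⟨inferInstanceAs (NormedAddCommGroup S), inferInstanceAs (NormedSpace ℚ S), rfl,
    inferInstanceAs (FiniteDimensional ℚ S), ?_, Fintype.card κ, fun j =>
      (LinearMap.proj ((Fintype.equivFin κ).symm j)).comp S.subtype, ?_⟩
  · intro x
    obtain ⟨i, hi⟩ := exists_norm_eq_abs_apply x.1
    exact ⟨_, hi⟩
  · intro x
    constructor
    · obtain ⟨i, hi⟩ := exists_norm_eq_abs_apply x.1
      refine ⟨Fintype.equivFin κ i, ?_⟩
      change _ = ‖x.1‖
      rw [hi]
      simp
    · rintro _ ⟨j, rfl⟩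
      change _ ≤ ‖x.1‖
      dsimp only
      rw [Rat.cast_abs, ← Real.norm_eq_abs, Rat.norm_cast_real]
      exact norm_le_pi_norm x.1 ((Fintype.equivFin κ).symm j)

/-- Isometric maps from subspaces of finite powers of `ℚ` to the rational Gurarii space extend. -/
theorem IsRationalGurarii.exists_extension_submodule (hV : IsRationalGurarii V) {κ : Type u} [Fintype κ]
    [Nonempty κ] (S : Submodule ℚ (κ → ℚ)) (φ : S →ₗ[ℚ] V) (hφ : ∀ x, ‖φ x‖ = ‖x‖) :
    ∃ Φ : (κ → ℚ) →ₗ[ℚ] V, (∀ x : S, Φ x = φ x) ∧ ∀ x, ‖Φ x‖ = ‖x‖ := by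
  let := normStructure V
  have := hV.countable
  let := normStructure S
  let := normStructure (κ → ℚ)
  have hS := mem_polyhedralClass_submodule S
  rw [← hV.isFraisseLimit.age] at hS
  -- From `S` only finite generation is needed; from the whole space, some embedding into `V`, which
  -- ultrahomogeneity then adjusts to extend `φ`.
  have hT := mem_polyhedralClass_submodule (⊤ : Submodule ℚ (κ → ℚ))
  rw [← hV.isFraisseLimit.age] at hT
  obtain ⟨t⟩ := hT.2
  let e : (κ → ℚ) →ₗ[ℚ] (⊤ : Submodule ℚ (κ → ℚ)) := Submodule.topEquiv.symm.toLinearMap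
  let := normStructure (⊤ : Submodule ℚ (κ → ℚ))
  have : Nonempty ((κ → ℚ) ↪[normLang] V) :=
    ⟨Embedding.comp t (normEmbedding e fun x => rfl)⟩
  obtain ⟨F, hF⟩ := hV.isFraisseLimit.ultrahomogeneous.extend_embedding hS.1
    (normEmbedding φ hφ) (normEmbedding S.subtype fun x => rfl)
  obtain ⟨Φ, h1, h2⟩ := exists_linearMap_of_embedding (V := κ → ℚ) 
    (fun x => (exists_norm_eq_abs_apply x).imp' _ fun _ => id) F
  refine ⟨Φ, fun x => ?_, h2⟩
  rw [h1]
  exact (DFunLike.congr_fun hF x).symm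

/-- An isometric map to the rational Gurarii space from a subspace of a vector space with the norm
`‖T x‖`, where `T` is an injective map to a finite power of `ℚ`, extends to the whole space. -/
theorem IsRationalGurarii.exists_extension (hV : IsRationalGurarii V) {X : Type*} {κ : Type} [Fintype κ]
    [Nonempty κ] [AddCommGroup X] [Module ℚ X] (T : X →ₗ[ℚ] (κ → ℚ))
    (hT : Function.Injective T) (S : Submodule ℚ X) (φ : X →ₗ[ℚ] V)
    (hφ : ∀ x ∈ S, ‖φ x‖ = ‖T x‖) :
    ∃ Φ : X →ₗ[ℚ] V, (∀ x ∈ S, Φ x = φ x) ∧ ∀ x, ‖Φ x‖ = ‖T x‖ := by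
  -- The class lives in the universe of `V`, so the index type is lifted there.
  let e : (κ → ℚ) →ₗ[ℚ] (ULift.{u} κ → ℚ) := LinearMap.funLeft ℚ ℚ ULift.down
  have he : ∀ x, ‖e x‖ = ‖x‖ := by
    intro x
    apply le_antisymm
    · exact (pi_norm_le_iff_of_nonneg (norm_nonneg _)).2 fun i => norm_le_pi_norm x i.down
    · exact (pi_norm_le_iff_of_nonneg (norm_nonneg _)).2 fun i => norm_le_pi_norm (e x) ⟨i⟩
  have he' : Function.Injective e := (injective_iff_map_eq_zero e).2 fun x hx => by
    rw [← norm_eq_zero, ← he, hx, norm_zero]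
  have hinj : Function.Injective (e.comp T) := he'.comp hT
  obtain ⟨g, hg⟩ := (e.comp T).exists_leftInverse_of_injective (LinearMap.ker_eq_bot.2 hinj)
  have hg' : ∀ x, g (e (T x)) = x := fun x => LinearMap.congr_fun hg x
  let ψ : S.map (e.comp T) →ₗ[ℚ] V := (φ.comp g).comp (S.map (e.comp T)).subtype
  have hψ : ∀ x, ‖ψ x‖ = ‖x‖ := by
    rintro ⟨_, x, hx, rfl⟩
    change ‖φ (g (e (T x)))‖ = ‖e (T x)‖
    rw [hg', hφ x hx, he]
  obtain ⟨Φ, h1, h2⟩ := hV.exists_extension_submodule (S.map (e.comp T)) ψ hψ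
  refine ⟨Φ.comp (e.comp T), fun x hx => ?_, fun x => (h2 _).trans (he _)⟩
  refine (h1 ⟨e (T x), x, hx, rfl⟩).trans ?_
  change φ (g (e (T x))) = φ x
  rw [hg']

end ModelTheory

/-! ### Approximation by functionals with rational values on a basis -/

section RationalCoordinates

open Module

variable {ι F : Type*} [NormedAddCommGroup F] [NormedSpace ℝ F]

/-- The real functional with prescribed rational values on a basis. -/
noncomputable def ratFunctional (b : Basis ι ℝ F) (u : ι → ℚ) : F →ₗ[ℝ] ℝ :=
  b.constr ℝ fun i => (u i : ℝ)

theorem ratFunctional_basis (b : Basis ι ℝ F) (u : ι → ℚ) (i : ι) :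
    ratFunctional b u (b i) = u i :=
  b.constr_basis ℝ _ i

variable [Fintype ι]

/-- The vectors with rational coordinates in a given basis are dense. -/
theorem denseRange_sum_ratCast_smul (b : Basis ι ℝ F) :
    DenseRange fun a : ι → ℚ => ∑ i, (a i : ℝ) • b i := by
  have : FiniteDimensional ℝ F := b.finiteDimensional_of_finite
  have h1 : DenseRange (Pi.map fun (_ : ι) (q : ℚ) => (q : ℝ)) :=
    DenseRange.piMap fun _ => Rat.isDenseEmbedding_coe_real.dense
  have h2 : Continuous b.equivFun.symm := LinearMap.continuous_of_finiteDimensional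
    (b.equivFun.symm : (ι → ℝ) →ₗ[ℝ] F)
  have h3 := b.equivFun.symm.surjective.denseRange.comp h1 h2
  convert h3 using 1
  ext a
  simp [Basis.equivFun_symm_apply]

/-- Coordinates in a basis are bounded by a multiple of the norm. -/
theorem exists_sum_abs_repr_le (b : Basis ι ℝ F) :
    ∃ C : ℝ, 0 < C ∧ ∀ x, ∑ i, |b.repr x i| ≤ C * ‖x‖ := by
  have : FiniteDimensional ℝ F := b.finiteDimensional_of_finite
  let L : ι → F →L[ℝ] ℝ := fun i => LinearMap.toContinuousLinearMap (b.coord i)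
  refine ⟨∑ i, ‖L i‖ + 1, by positivity, fun x => ?_⟩
  have : ∑ i, |b.repr x i| ≤ ∑ i, ‖L i‖ * ‖x‖ :=
    Finset.sum_le_sum fun i _ => (L i).le_opNorm x
  rw [← Finset.sum_mul] at this
  nlinarith [norm_nonneg x]

/-- Linear maps that are close on a basis are close. -/
theorem norm_sub_le_of_basis {G : Type*} [NormedAddCommGroup G] [NormedSpace ℝ G]
    (b : Basis ι ℝ F) {C : ℝ} (hC : ∀ x, ∑ i, |b.repr x i| ≤ C * ‖x‖) {δ : ℝ} (hδ : 0 ≤ δ)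
    (A B : F →ₗ[ℝ] G) (h : ∀ i, ‖A (b i) - B (b i)‖ ≤ δ) (x : F) :
    ‖A x - B x‖ ≤ C * δ * ‖x‖ := by
  have hx : A x - B x = ∑ i, b.repr x i • (A (b i) - B (b i)) := by
    conv_lhs => rw [← b.sum_repr x]
    simp only [map_sum, map_smul, smul_sub, Finset.sum_sub_distrib]
  rw [hx]
  calc ‖∑ i, b.repr x i • (A (b i) - B (b i))‖ ≤ ∑ i, |b.repr x i| * δ := by
        refine norm_sum_le_of_le _ fun i _ => ?_
        rw [norm_smul, Real.norm_eq_abs]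
        exact mul_le_mul_of_nonneg_left (h i) (abs_nonneg _)
    _ = (∑ i, |b.repr x i|) * δ := by rw [Finset.sum_mul]
    _ ≤ C * ‖x‖ * δ := mul_le_mul_of_nonneg_right (hC x) hδ
    _ = C * δ * ‖x‖ := by ring

theorem ratFunctional_sum (b : Basis ι ℝ F) (u a : ι → ℚ) :
    ratFunctional b u (∑ i, (a i : ℝ) • b i) = ((∑ i, a i * u i : ℚ) : ℝ) := by
  simp [ratFunctional_basis]

/-- Every functional is approximated by functionals with rational values on a basis, and the
approximation may be taken exact at the basis vectors at which the value is already rational. -/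
theorem exists_ratFunctional_near (b : Basis ι ℝ F) (ψ : F →ₗ[ℝ] ℝ) {η : ℝ} (hη : 0 < η) :
    ∃ u : ι → ℚ, (∀ i (q : ℚ), ψ (b i) = q → u i = q) ∧
      ∀ x, |ratFunctional b u x - ψ x| ≤ η * ‖x‖ := by
  obtain ⟨C, hC, hC'⟩ := exists_sum_abs_repr_le b
  -- An error of `η / C` at each basis vector costs `η * ‖x‖` at `x`.
  have : ∀ i, ∃ r : ℚ, (∀ q : ℚ, ψ (b i) = q → r = q) ∧ |(r : ℝ) - ψ (b i)| ≤ η / C := by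
    intro i
    by_cases h : ∃ q : ℚ, ψ (b i) = q
    · obtain ⟨q, hq⟩ := h
      refine ⟨q, fun r hr => ?_, ?_⟩
      · exact_mod_cast hq.symm.trans hr
      · rw [hq, sub_self, abs_zero]
        positivity
    · obtain ⟨r, h1, h2⟩ := exists_rat_btwn (show ψ (b i) < ψ (b i) + η / C by
        have : 0 < η / C := by positivity
        linarith)
      refine ⟨r, fun q hq => (h ⟨q, hq⟩).elim, ?_⟩
      rw [abs_le]
      constructor <;> linarith
  choose u h1 h2 using this
  refine ⟨u, h1, fun x => ?_⟩
  have := norm_sub_le_of_basis b hC' (δ := η / C) (by positivity) (ratFunctional b u) ψ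
    (fun i => by rw [ratFunctional_basis]; exact h2 i) x
  rwa [mul_div_cancel₀ _ hC.ne'] at this

/-- A norm is approximated from below by finitely many functionals that are rational in a given
basis. -/
theorem exists_finite_ratFunctional_net {F : Type} [NormedAddCommGroup F] [NormedSpace ℝ F]
    (b : Basis ι ℝ F) {δ : ℝ} (hδ : 0 < δ) (hδ' : 2 * δ ≤ 1) :
    ∃ (κ : Type) (_ : Fintype κ) (w : κ → ι → ℚ),
      (∀ k x, |ratFunctional b (w k) x| ≤ (1 - δ) * ‖x‖) ∧
      ∀ x, x ≠ 0 → ∃ k, (1 - 4 * δ) * ‖x‖ ≤ |ratFunctional b (w k) x| := by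
  have : FiniteDimensional ℝ F := b.finiteDimensional_of_finite
  have key : ∀ y : F, ∃ u : ι → ℚ, (∀ x, |ratFunctional b u x| ≤ (1 - δ) * ‖x‖) ∧
      (‖y‖ = 1 → 1 - 4 * δ < ratFunctional b u y) := by
    intro y
    obtain ⟨g, hg, hgy⟩ := exists_dual_vector'' ℝ y
    -- Shrinking by `1 - 2 * δ` and rounding within `δ` keeps the norm below `1 - δ` and the value
    -- at a unit vector `y` at least `1 - 3 * δ`. The strict bound `1 - 4 * δ` then defines an open
    -- neighbourhood, and compactness of the sphere applies.
    obtain ⟨u, -, hu⟩ := exists_ratFunctional_near b ((1 - 2 * δ) • (g : F →ₗ[ℝ] ℝ)) hδ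
    refine ⟨u, fun x => ?_, fun hy => ?_⟩
    · have h1 := hu x
      have h2 : |g x| ≤ ‖x‖ := (g.le_opNorm x).trans (by nlinarith [norm_nonneg x])
      have h3 : |(1 - 2 * δ) * g x| ≤ (1 - 2 * δ) * ‖x‖ := by
        rw [abs_mul, abs_of_nonneg (by linarith)]
        exact mul_le_mul_of_nonneg_left h2 (by linarith)
      simp only [LinearMap.smul_apply, smul_eq_mul, ContinuousLinearMap.coe_coe] at h1
      rw [abs_le] at *
      constructor <;> linarith
    · have h1 := hu y
      simp only [LinearMap.smul_apply, smul_eq_mul, ContinuousLinearMap.coe_coe] at h1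
      rw [hgy, hy, abs_le] at h1
      norm_num at h1
      linarith
  choose u hu1 hu2 using key
  obtain ⟨t, ht⟩ := (isCompact_sphere (0 : F) 1).elim_finite_subcover
    (fun y => {x | 1 - 4 * δ < ratFunctional b (u y) x})
    (fun y => isOpen_lt continuous_const (LinearMap.continuous_of_finiteDimensional _))
    (fun y hy => Set.mem_iUnion.2 ⟨y, hu2 y (by simpa using hy)⟩)
  refine ⟨t, inferInstance, fun k => u k, fun k x => hu1 k x, fun x hx => ?_⟩
  have hx' : 0 < ‖x‖ := norm_pos_iff.2 hx
  have hy : ‖x‖⁻¹ • x ∈ Metric.sphere (0 : F) 1 := by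
    simp [norm_smul, hx'.ne']
  obtain ⟨y, hyt, hy⟩ : ∃ y ∈ t, 1 - 4 * δ < ratFunctional b (u y) (‖x‖⁻¹ • x) := by
    simpa using ht hy
  refine ⟨⟨y, hyt⟩, ?_⟩
  rw [map_smul, smul_eq_mul, inv_mul_eq_div, lt_div_iff₀ hx'] at hy
  exact hy.le.trans (le_abs_self _)

end RationalCoordinates

/-! ### The completion has the extension property -/

section Existence

open Module

/-- Every basis of a subspace can be extended to a basis of the whole space. -/
theorem exists_basis_extending {F : Type*} [AddCommGroup F] [Module ℝ F]
    [FiniteDimensional ℝ F] (E : Submodule ℝ F) :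
    ∃ (k l : ℕ) (bE : Basis (Fin k) ℝ E) (b : Basis (Fin k ⊕ Fin l) ℝ F),
      ∀ i, b (Sum.inl i) = bE i := by
  obtain ⟨C, hC⟩ := E.exists_isCompl
  refine ⟨_, _, finBasis ℝ E,
    ((finBasis ℝ E).prod (finBasis ℝ C)).map (E.prodEquivOfIsCompl C hC), fun i => ?_⟩
  simp

/-- A functional on a subspace with rational values on a basis extends, with almost the same norm,
to a functional on the whole space with rational values on an extended basis. -/
theorem exists_ratFunctional_extension {k l : ℕ} {F : Type*} [NormedAddCommGroup F]
    [NormedSpace ℝ F] {E : Submodule ℝ F} (bE : Basis (Fin k) ℝ E)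
    (b : Basis (Fin k ⊕ Fin l) ℝ F) (hb : ∀ i, b (Sum.inl i) = bE i) {δ : ℝ} (hδ : 0 < δ)
    (c : Fin k → ℚ)
    (hc : ∀ a : Fin k → ℚ, |((∑ i, a i * c i : ℚ) : ℝ)| ≤ (1 + δ) * ‖∑ i, (a i : ℝ) • bE i‖) :
    ∃ u : Fin k ⊕ Fin l → ℚ, (∀ i, u (Sum.inl i) = c i) ∧
      ∀ x, |ratFunctional b u x| ≤ (1 + 2 * δ) * ‖x‖ := by
  have : FiniteDimensional ℝ F := b.finiteDimensional_of_finite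
  have h1 : ∀ x, ‖ratFunctional bE c x‖ ≤ (1 + δ) * ‖x‖ := by
    intro x
    induction x using (denseRange_sum_ratCast_smul bE).induction_on with
    | hp =>
      exact isClosed_le (LinearMap.continuous_of_finiteDimensional _).norm (by fun_prop)
    | ih a => rw [ratFunctional_sum]; exact hc a
  -- Hahn–Banach keeps the norm bound `1 + δ`; rounding adds another `δ` but leaves the already
  -- rational values on the basis of `E` intact.
  obtain ⟨ψ, hψ, hψn⟩ := exists_extension_norm_eq E
    ((ratFunctional bE c).mkContinuous (1 + δ) h1)
  have h2 : ‖ψ‖ ≤ 1 + δ := hψn ▸ LinearMap.mkContinuous_norm_le _ (by positivity) h1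
  obtain ⟨u, hu1, hu2⟩ := exists_ratFunctional_near b (ψ : F →ₗ[ℝ] ℝ) hδ
  refine ⟨u, fun i => hu1 _ _ ?_, fun x => ?_⟩
  · rw [hb, ContinuousLinearMap.coe_coe, hψ]
    exact ratFunctional_basis bE c i
  · have h3 := hu2 x
    have h4 : |ψ x| ≤ (1 + δ) * ‖x‖ := ψ.le_of_opNorm_le h2 x
    simp only [ContinuousLinearMap.coe_coe] at h3
    rw [abs_le] at *
    constructor <;> linarith

theorem linearMap_apply_eq_sum_single {ι W : Type*} [Fintype ι] [DecidableEq ι] [AddCommGroup W]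
    [Module ℚ W] (f : (ι → ℚ) →ₗ[ℚ] W) (a : ι → ℚ) : f a = ∑ i, a i • f (Pi.single i 1) := by
  conv_lhs => rw [pi_eq_sum_univ' a]
  simp only [map_sum, map_smul]

variable {V : Type u} [NormedAddCommGroup V] [NormedSpace ℚ V]

theorem sum_ratCast_smul_coe {ι : Type*} [Fintype ι] (a : ι → ℚ) (v : ι → V) :
    ∑ i, (a i : ℝ) • (v i : Completion V) = ((∑ i, a i • v i : V) : Completion V) := by
  simp_rw [ratCast_smul_coe]
  exact (map_sum (Completion.toCompl : V →+ Completion V) _ _).symm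

/-- Given rational vectors that almost span an isometric copy of `E`, the rational linear map
defined by them extends to an almost isometric one on the rational vectors of `F`. -/
theorem IsRationalGurarii.exists_almost_isometric_extension (hV : IsRationalGurarii V) {k l : ℕ}
    {F : Type} [NormedAddCommGroup F] [NormedSpace ℝ F] {E : Submodule ℝ F}
    (bE : Basis (Fin k) ℝ E) (b : Basis (Fin k ⊕ Fin l) ℝ F)
    (hb : ∀ i, b (Sum.inl i) = bE i) {δ : ℝ} (hδ : 0 < δ) (hδ' : 8 * δ ≤ 1) (v : Fin k → V)
    (hv1 : ∀ a : Fin k → ℚ, ‖∑ i, a i • v i‖ ≤ (1 + δ) * ‖∑ i, (a i : ℝ) • bE i‖)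
    (hv2 : ∀ a : Fin k → ℚ, (1 - δ) * ‖∑ i, (a i : ℝ) • bE i‖ ≤ ‖∑ i, a i • v i‖) :
    ∃ Φ : (Fin k ⊕ Fin l → ℚ) →ₗ[ℚ] V, (∀ i, Φ (Pi.single (Sum.inl i) 1) = v i) ∧
      ∀ a, (1 - 4 * δ) * ‖∑ i, (a i : ℝ) • b i‖ ≤ ‖Φ a‖ ∧
        ‖Φ a‖ ≤ (1 + 2 * δ) * ‖∑ i, (a i : ℝ) • b i‖ := by
  obtain ⟨n, TE, hn, hTE⟩ := hV.exists_polyhedral v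
  have : NeZero n := ⟨hn.ne'⟩
  obtain ⟨κ, _, w, hw1, hw2⟩ := exists_finite_ratFunctional_net b hδ (by linarith)
  have hcoord : ∀ (a : Fin k → ℚ) j, TE a j = ∑ i, a i * TE (Pi.single i 1) j := by
    intro a j
    conv_lhs => rw [linearMap_apply_eq_sum_single TE a]
    simp [Finset.sum_apply]
  have hu : ∀ j : Fin n, ∃ u : Fin k ⊕ Fin l → ℚ,
      (∀ i, u (Sum.inl i) = TE (Pi.single i 1) j) ∧
        ∀ x, |ratFunctional b u x| ≤ (1 + 2 * δ) * ‖x‖ := by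
    intro j
    refine exists_ratFunctional_extension bE b hb hδ _ fun a => ?_
    refine le_trans ?_ (hv1 a)
    rw [← hcoord, ← hTE, ← Real.norm_eq_abs, Rat.norm_cast_real]
    exact norm_le_pi_norm (TE a) j
  choose u hu1 hu2 using hu
  let J : (Fin k ⊕ Fin l → ℚ) → F := fun a => ∑ i, (a i : ℝ) • b i
  let T : (Fin k ⊕ Fin l → ℚ) →ₗ[ℚ] (Fin n ⊕ κ → ℚ) :=
    Matrix.mulVecLin (Matrix.of (Sum.elim u w))
  have hT : ∀ a s, T a s = ∑ i, a i * Sum.elim u w s i := by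
    intro a s
    simp only [T, Matrix.mulVecLin_apply, Matrix.mulVec, dotProduct, Matrix.of_apply]
    exact Finset.sum_congr rfl fun i _ => mul_comm _ _
  have hTJ : ∀ a s, ‖T a s‖ = |ratFunctional b (Sum.elim u w s) (J a)| := by
    intro a s
    rw [ratFunctional_sum, ← hT, ← Real.norm_eq_abs, Rat.norm_cast_real]
  have hup : ∀ a, ‖T a‖ ≤ (1 + 2 * δ) * ‖J a‖ := by
    intro a
    refine (pi_norm_le_iff_of_nonneg (by positivity)).2 ?_
    rintro (j | j)
    · rw [hTJ]
      exact hu2 j _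
    · rw [hTJ]
      exact (hw1 j _).trans (mul_le_mul_of_nonneg_right (by linarith) (norm_nonneg _))
  have hlow : ∀ a, (1 - 4 * δ) * ‖J a‖ ≤ ‖T a‖ := by
    intro a
    by_cases h : J a = 0
    · simp [h]
    · obtain ⟨j, hj⟩ := hw2 _ h
      refine hj.trans ?_
      change |ratFunctional b (Sum.elim u w (Sum.inr j)) (J a)| ≤ _
      rw [← hTJ]
      exact norm_le_pi_norm _ _
  have hinj : Function.Injective T := by
    refine (injective_iff_map_eq_zero T).2 fun a ha => ?_
    have h1 := hlow a
    rw [ha, norm_zero] at h1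
    have h2 : J a = 0 := by
      rw [← norm_le_zero_iff]
      nlinarith [norm_nonneg (J a)]
    ext i
    have h3 := Fintype.linearIndependent_iff.1 b.linearIndependent (fun i => (a i : ℝ)) h2 i
    exact_mod_cast h3
  let S : Submodule ℚ (Fin k ⊕ Fin l → ℚ) :=
    ⨅ j : Fin l, LinearMap.ker (LinearMap.proj (Sum.inr j))
  have hS : ∀ a, a ∈ S ↔ ∀ j, a (Sum.inr j) = 0 := fun a => by
    simp [S, Submodule.mem_iInf]
  let φ : (Fin k ⊕ Fin l → ℚ) →ₗ[ℚ] V :=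
    (Fintype.linearCombination ℚ v).comp (LinearMap.funLeft ℚ ℚ Sum.inl)
  have hφ : ∀ a, φ a = ∑ i, a (Sum.inl i) • v i := fun a => rfl
  have hφT : ∀ a ∈ S, ‖φ a‖ = ‖T a‖ := by
    intro a ha
    rw [hS] at ha
    have hJ : J a = ∑ i, (a (Sum.inl i) : ℝ) • bE i := by
      simp [J, ha, hb]
    have hl : ∀ j, T a (Sum.inl j) = TE (fun i => a (Sum.inl i)) j := by
      intro j
      rw [hT, hcoord]
      simp [ha, hu1]
    rw [hφ, ← hTE]
    apply le_antisymm
    · refine (pi_norm_le_iff_of_nonneg (norm_nonneg _)).2 fun j => ?_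
      rw [← hl]
      exact norm_le_pi_norm _ _
    · refine (pi_norm_le_iff_of_nonneg (norm_nonneg _)).2 ?_
      rintro (j | j)
      · rw [hl]
        exact norm_le_pi_norm _ _
      -- The net functionals add nothing on `E`: their bound `1 - δ` is exactly the lower distortion
      -- bound in `hv2`.
      · rw [hTJ, hTE]
        refine (hw1 j _).trans ?_
        rw [hJ]
        exact hv2 _
  obtain ⟨Φ, hΦ1, hΦ2⟩ := hV.exists_extension T hinj S φ hφT
  refine ⟨Φ, fun i => ?_, fun a => ?_⟩
  · rw [hΦ1 _ ((hS _).2 fun j => by simp), hφ]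
    simp [Pi.single_apply]
  · rw [hΦ2]
    exact ⟨hlow a, hup a⟩

/-- Almost isometric extension of isometric maps to the completion of the rational Gurarii space. -/
theorem IsRationalGurarii.completion_extension (hV : IsRationalGurarii V) {δ : ℝ} (hδ : 0 < δ)
    (hδ' : 8 * δ ≤ 1) (F : Type) [NormedAddCommGroup F] [NormedSpace ℝ F]
    [FiniteDimensional ℝ F] (E : Submodule ℝ F) (φ : E →ₗᵢ[ℝ] Completion V) :
    ∃ Φ : F →ₗ[ℝ] Completion V, (∀ x : E, Φ x = φ x) ∧
      ∀ x, (1 - 5 * δ) * ‖x‖ ≤ ‖Φ x‖ ∧ ‖Φ x‖ ≤ (1 + 3 * δ) * ‖x‖ := by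
  obtain ⟨k, l, bE, b, hb⟩ := exists_basis_extending E
  obtain ⟨CE, hCE, hCE'⟩ := exists_sum_abs_repr_le bE
  obtain ⟨C, hC, hC'⟩ := exists_sum_abs_repr_le b
  -- The constant `CE` serves to compare norms on `E`, and `C` to control the final correction on
  -- `F`.
  have hv : ∀ i, ∃ v : V, ‖φ (bE i) - (v : Completion V)‖ ≤ δ / max CE C := by
    intro i
    obtain ⟨v, hv⟩ := Completion.denseRange_coe.exists_dist_lt (φ (bE i))
      (show 0 < δ / max CE C by positivity)
    exact ⟨v, by rw [← dist_eq_norm]; exact hv.le⟩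
  choose v hv using hv
  have hvE : ∀ a : Fin k → ℚ,
      |‖∑ i, a i • v i‖ - ‖∑ i, (a i : ℝ) • bE i‖| ≤ δ * ‖∑ i, (a i : ℝ) • bE i‖ := by
    intro a
    have h := norm_sub_le_of_basis bE hCE' (δ := δ / max CE C) (by positivity)
      (bE.constr ℝ fun i => (v i : Completion V)) φ.toLinearMap (fun i => by
        rw [bE.constr_basis, norm_sub_rev]; exact hv i) (∑ i, (a i : ℝ) • bE i)
    have h1 : bE.constr ℝ (fun i => (v i : Completion V)) (∑ i, (a i : ℝ) • bE i) =
        ((∑ i, a i • v i : V) : Completion V) := by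
      rw [← sum_ratCast_smul_coe]
      simp
    have h2 : CE * (δ / max CE C) ≤ δ := by
      rw [mul_div_assoc', div_le_iff₀ (by positivity), mul_comm]
      exact mul_le_mul_of_nonneg_left (le_max_left _ _) hδ.le
    rw [h1] at h
    have h3 := (abs_norm_sub_norm_le _ _).trans h
    rw [Completion.norm_coe, LinearIsometry.coe_toLinearMap, φ.norm_map] at h3
    exact h3.trans (mul_le_mul_of_nonneg_right h2 (norm_nonneg _))
  obtain ⟨Φ₀, h1, h2⟩ := hV.exists_almost_isometric_extension bE b hb hδ hδ' v
    (fun a => by have := (abs_le.1 (hvE a)).2; linarith)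
    (fun a => by have := (abs_le.1 (hvE a)).1; linarith)
  let Φ₁ : F →ₗ[ℝ] Completion V :=
    b.constr ℝ fun i => ((Φ₀ (Pi.single i 1) : V) : Completion V)
  -- `Φ₁` extends `φ` only approximately. Replacing its values on the basis of `E` makes the
  -- extension exact, at the cost of one more `δ` in each bound.
  let Φ : F →ₗ[ℝ] Completion V :=
    b.constr ℝ (Sum.elim (fun i => φ (bE i)) fun j => Φ₁ (b (Sum.inr j)))
  have hΦ₁ : ∀ a : Fin k ⊕ Fin l → ℚ,
      Φ₁ (∑ i, (a i : ℝ) • b i) = ((Φ₀ a : V) : Completion V) := by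
    intro a
    rw [linearMap_apply_eq_sum_single Φ₀ a, ← sum_ratCast_smul_coe, map_sum]
    simp only [Φ₁, map_smul, b.constr_basis]
  have hcont : Continuous Φ₁ := LinearMap.continuous_of_finiteDimensional _
  have hlow : ∀ x, (1 - 4 * δ) * ‖x‖ ≤ ‖Φ₁ x‖ := by
    intro x
    induction x using (denseRange_sum_ratCast_smul b).induction_on with
    | hp => exact isClosed_le (by fun_prop) hcont.norm
    | ih a => rw [hΦ₁, Completion.norm_coe]; exact (h2 a).1
  have hup : ∀ x, ‖Φ₁ x‖ ≤ (1 + 2 * δ) * ‖x‖ := by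
    intro x
    induction x using (denseRange_sum_ratCast_smul b).induction_on with
    | hp => exact isClosed_le hcont.norm (by fun_prop)
    | ih a => rw [hΦ₁, Completion.norm_coe]; exact (h2 a).2
  have hclose : ∀ x, ‖Φ x - Φ₁ x‖ ≤ δ * ‖x‖ := by
    intro x
    have h := norm_sub_le_of_basis b hC' (δ := δ / max CE C) (by positivity) Φ Φ₁ (by
      rintro (i | j)
      · simp only [Φ, Φ₁, b.constr_basis, Sum.elim_inl, h1]
        exact hv i
      · simp only [Φ, b.constr_basis, Sum.elim_inr, sub_self, norm_zero]
        positivity) x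
    refine h.trans (mul_le_mul_of_nonneg_right ?_ (norm_nonneg _))
    rw [mul_div_assoc', div_le_iff₀ (by positivity), mul_comm]
    exact mul_le_mul_of_nonneg_left (le_max_right _ _) hδ.le
  refine ⟨Φ, fun x => ?_, fun x => ?_⟩
  · have : Φ.comp E.subtype = φ.toLinearMap := bE.ext fun i => by
      simp [Φ, ← hb]
    exact LinearMap.congr_fun this x
  · have h3 := (abs_norm_sub_norm_le _ _).trans (hclose x)
    rw [abs_le] at h3
    have h4 := hlow x
    have h5 := hup x
    constructor <;> linarith

/-- The completion of the rational Gurarii space is a Gurarii space. -/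
theorem IsRationalGurarii.isGurarii_completion (hV : IsRationalGurarii V) :
    IsGurarii (Completion V) where
  complete := inferInstance
  separable := by
    have := hV.countable
    exact (Completion.denseRange_coe (α := V)).separableSpace (Completion.continuous_coe V)
  extension := by
    intro ε hε F _ _ _ E φ
    have hm : 0 < min ε 1 := by positivity
    -- With this `δ`, `5 * δ ≤ ε / 2` makes the inequalities strict, and `5 * δ ≤ 1 / 2` gives
    -- injectivity.
    obtain ⟨Φ, h1, h2⟩ := hV.completion_extension (δ := min ε 1 / 10) (by positivity)
      (by have := min_le_right ε 1; linarith) F E φ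
    have h3 := min_le_left ε 1
    have h4 := min_le_right ε 1
    refine ⟨Φ, (injective_iff_map_eq_zero Φ).2 fun x hx => ?_, h1, fun x hx => ?_⟩
    · have h5 := (h2 x).1
      rw [hx, norm_zero] at h5
      rw [← norm_le_zero_iff]
      nlinarith [norm_nonneg x]
    · have hx' := norm_pos_iff.2 hx
      have h5 := h2 x
      constructor
      · refine lt_of_lt_of_le ?_ h5.1
        exact mul_lt_mul_of_pos_right (by linarith) hx'
      · refine h5.2.trans_lt ?_
        exact mul_lt_mul_of_pos_right (by linarith) hx'

end Existence

/-! ### Amalgamation and back-and-forth between Gurarii spaces -/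

section Uniqueness

open Module Filter Topology

/-- The coordinate space `ℝⁿ` without any chosen norm. -/
def CoordSpace (n : ℕ) : Type := Fin n → ℝ

noncomputable instance (n : ℕ) : AddCommGroup (CoordSpace n) :=
  inferInstanceAs (AddCommGroup (Fin n → ℝ))

noncomputable instance (n : ℕ) : Module ℝ (CoordSpace n) :=
  inferInstanceAs (Module ℝ (Fin n → ℝ))

instance (n : ℕ) : FiniteDimensional ℝ (CoordSpace n) :=
  inferInstanceAs (FiniteDimensional ℝ (Fin n → ℝ))

variable {G H : Type*} [NormedAddCommGroup G] [NormedSpace ℝ G]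
  [NormedAddCommGroup H] [NormedSpace ℝ H]

/-- The extension property of the Gurarii space for a finite-dimensional space, in any universe,
whose norm is given as a definite seminorm. -/
theorem IsGurarii.exists_extension_seminorm (hG : IsGurarii G) {Z : Type*} [AddCommGroup Z]
    [Module ℝ Z] [FiniteDimensional ℝ Z] (p : Seminorm ℝ Z) (hp : ∀ z, p z = 0 → z = 0)
    (S : Submodule ℝ Z) (φ : Z →ₗ[ℝ] G) (hφ : ∀ z ∈ S, ‖φ z‖ = p z) {ε : ℝ} (hε : 0 < ε) :
    ∃ Φ : Z →ₗ[ℝ] G, (∀ z ∈ S, Φ z = φ z) ∧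
      ∀ z, (1 - ε) * p z ≤ ‖Φ z‖ ∧ ‖Φ z‖ ≤ (1 + ε) * p z := by
  -- The extension property quantifies over `F : Type`, so `p` is transported to coordinates, on a
  -- synonym that carries no competing sup norm.
  let e : Z ≃ₗ[ℝ] CoordSpace (finrank ℝ Z) := (finBasis ℝ Z).equivFun
  let : Norm (CoordSpace (finrank ℝ Z)) := ⟨fun x => p (e.symm x)⟩
  have hnorm : ∀ x : CoordSpace (finrank ℝ Z), ‖x‖ = p (e.symm x) := fun _ => rfl
  have core : NormedSpace.Core ℝ (CoordSpace (finrank ℝ Z)) :=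
    { norm_nonneg := fun x => apply_nonneg p _
      norm_smul := fun c x => by rw [hnorm, map_smul, map_smul_eq_mul, hnorm]
      norm_triangle := fun x y => by
        rw [hnorm, map_add]
        exact map_add_le_add p _ _
      norm_eq_zero_iff := fun x => by
        rw [hnorm]
        refine ⟨fun h => by simpa using hp _ h, fun h => by simp [h]⟩ }
  let : NormedAddCommGroup (CoordSpace (finrank ℝ Z)) := NormedAddCommGroup.ofCore core
  let : NormedSpace ℝ (CoordSpace (finrank ℝ Z)) := NormedSpace.ofCore core
  let ψ : S.map (e : Z →ₗ[ℝ] CoordSpace (finrank ℝ Z)) →ₗᵢ[ℝ] G :=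
    { toLinearMap := (φ.comp (e.symm : CoordSpace (finrank ℝ Z) →ₗ[ℝ] Z)).comp
        (S.map (e : Z →ₗ[ℝ] CoordSpace (finrank ℝ Z))).subtype
      norm_map' := by
        rintro ⟨_, z, hz, rfl⟩
        change ‖φ (e.symm (e z))‖ = p (e.symm (e z))
        rw [e.symm_apply_apply, hφ z hz] }
  obtain ⟨Φ, -, h1, h2⟩ := hG.extension ε hε (CoordSpace (finrank ℝ Z)) (S.map (e : Z →ₗ[ℝ] _)) ψ
  refine ⟨Φ.comp (e : Z →ₗ[ℝ] _), fun z hz => ?_, fun z => ?_⟩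
  · refine (h1 ⟨e z, z, hz, rfl⟩).trans ?_
    change φ (e.symm (e z)) = φ z
    rw [e.symm_apply_apply]
  · by_cases hz : z = 0
    · simp [hz]
    · have h3 := h2 (e z) (by simpa using hz)
      rw [hnorm, e.symm_apply_apply] at h3
      exact ⟨h3.1.le, h3.2.le⟩

/-- A linear map is `ε`-isometric on a subspace if it changes norms there by a factor between
`1 - ε` and `1 + ε`. -/
def IsAlmostIsometricOn (ε : ℝ) (E : Submodule ℝ G) (f : G →ₗ[ℝ] H) : Prop :=
  ∀ x ∈ E, (1 - ε) * ‖x‖ ≤ ‖f x‖ ∧ ‖f x‖ ≤ (1 + ε) * ‖x‖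

/-- The seminorm on `E × F` that amalgamates `E` and `F` along an almost isometric map
`f : E → F`. -/
noncomputable def amalgamSeminorm (ε : NNReal) (E : Submodule ℝ G) (F : Submodule ℝ H)
    (f : G →ₗ[ℝ] H) : Seminorm ℝ (E × F) :=
  ((normSeminorm ℝ E).comp (LinearMap.fst ℝ E F) + (normSeminorm ℝ F).comp (LinearMap.snd ℝ E F)) ⊓
    (ε • (normSeminorm ℝ E).comp (LinearMap.fst ℝ E F) +
      (normSeminorm ℝ H).comp
        (F.subtype.comp (LinearMap.snd ℝ E F) + (f.comp E.subtype).comp (LinearMap.fst ℝ E F)))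

theorem amalgamSeminorm_le_left (ε : NNReal) (E : Submodule ℝ G) (F : Submodule ℝ H)
    (f : G →ₗ[ℝ] H) (x : E) (y : F) : amalgamSeminorm ε E F f (x, y) ≤ ‖x‖ + ‖y‖ := by
  have h : amalgamSeminorm ε E F f ≤ (normSeminorm ℝ E).comp (LinearMap.fst ℝ E F) +
      (normSeminorm ℝ F).comp (LinearMap.snd ℝ E F) := by
    exact inf_le_left (α := Seminorm ℝ (E × F))
  exact h (x, y)

theorem amalgamSeminorm_le_right (ε : NNReal) (E : Submodule ℝ G) (F : Submodule ℝ H)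
    (f : G →ₗ[ℝ] H) (x : E) (y : F) :
    amalgamSeminorm ε E F f (x, y) ≤ ε * ‖x‖ + ‖(y : H) + f x‖ := by
  have h : amalgamSeminorm ε E F f ≤ ε • (normSeminorm ℝ E).comp (LinearMap.fst ℝ E F) +
      (normSeminorm ℝ H).comp (F.subtype.comp (LinearMap.snd ℝ E F) +
        (f.comp E.subtype).comp (LinearMap.fst ℝ E F)) := by
    exact inf_le_right (α := Seminorm ℝ (E × F))
  exact h (x, y)

/-- The infimum of two seminorms is their infimal convolution, so lower bounds are checked on every
splitting of `(x, y)` into `(a, c)` and the remainder. -/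
theorem le_amalgamSeminorm {ε : NNReal} {E : Submodule ℝ G} {F : Submodule ℝ H}
    {f : G →ₗ[ℝ] H} {x : E} {y : F} {r : ℝ}
    (h : ∀ (a : E) (c : F), r ≤ ‖a‖ + ‖c‖ + (ε * ‖x - a‖ + ‖((y - c : F) : H) + f (x - a : E)‖)) :
    r ≤ amalgamSeminorm ε E F f (x, y) :=
  le_ciInf fun u : E × F => h u.1 u.2

/-- Only the lower estimate for `f` enters: `ε * ‖x - a‖ + ‖f (x - a)‖` is at least `‖x - a‖`, so no
splitting beats `‖x‖`. -/
theorem amalgamSeminorm_left {ε : NNReal} {E : Submodule ℝ G} {F : Submodule ℝ H}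
    {f : G →ₗ[ℝ] H} (hf : IsAlmostIsometricOn ε E f) (x : E) :
    amalgamSeminorm ε E F f (x, 0) = ‖x‖ := by
  apply le_antisymm
  · simpa using amalgamSeminorm_le_left ε E F f x 0
  · refine le_amalgamSeminorm fun a c => ?_
    have h1 := (hf _ (x - a).2).1
    have h2 : ‖f (x - a : E)‖ ≤ ‖c‖ + ‖((0 - c : F) : H) + f (x - a : E)‖ := by
      have := norm_add_le (c : H) (((0 - c : F) : H) + f (x - a : E))
      simpa using this
    have h3 : ‖x‖ ≤ ‖a‖ + ‖x - a‖ := by simpa using norm_add_le a (x - a)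
    rw [← Submodule.coe_norm] at h1
    linarith

/-- Dually, only the upper estimate enters: a detour through `a` costs `(1 + ε) * ‖a‖`, at least the
gain `‖f a‖`. -/
theorem amalgamSeminorm_right {ε : NNReal} {E : Submodule ℝ G} {F : Submodule ℝ H}
    {f : G →ₗ[ℝ] H} (hf : IsAlmostIsometricOn ε E f) (y : F) :
    amalgamSeminorm ε E F f (0, y) = ‖y‖ := by
  apply le_antisymm
  · simpa using amalgamSeminorm_le_left ε E F f 0 y
  · refine le_amalgamSeminorm fun a c => ?_
    have h1 := (hf _ a.2).2
    have h2 : ‖y‖ ≤ ‖f a‖ + ‖c‖ + ‖((y - c : F) : H) + f (0 - a : E)‖ := by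
      have := norm_add₃_le (a := f a) (b := (c : H)) (c := ((y - c : F) : H) + f (0 - a : E))
      refine le_trans (le_of_eq ?_) this
      rw [Submodule.coe_norm]
      congr 1
      simp
      abel
    rw [← Submodule.coe_norm] at h1
    rw [zero_sub, norm_neg]
    rw [zero_sub] at h2
    linarith

/-- Both seminorms dominate `min 1 ε * ‖x‖`, so the `E`-component vanishes; isometry on `F` handles
the other one. -/
theorem amalgamSeminorm_definite {ε : NNReal} (hε : 0 < ε) {E : Submodule ℝ G}
    {F : Submodule ℝ H} {f : G →ₗ[ℝ] H} (hf : IsAlmostIsometricOn ε E f) (z : E × F)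
    (hz : amalgamSeminorm ε E F f z = 0) : z = 0 := by
  obtain ⟨x, y⟩ := z
  have h1 : min 1 (ε : ℝ) * ‖x‖ ≤ 0 := by
    rw [← hz]
    refine le_amalgamSeminorm fun a c => ?_
    have h3 : ‖x‖ ≤ ‖a‖ + ‖x - a‖ := by simpa using norm_add_le a (x - a)
    have h4 : min 1 (ε : ℝ) * ‖a‖ ≤ 1 * ‖a‖ :=
      mul_le_mul_of_nonneg_right (min_le_left _ _) (norm_nonneg _)
    have h5 : min 1 (ε : ℝ) * ‖x - a‖ ≤ ε * ‖x - a‖ :=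
      mul_le_mul_of_nonneg_right (min_le_right _ _) (norm_nonneg _)
    have h6 : min 1 (ε : ℝ) * ‖x‖ ≤ min 1 (ε : ℝ) * (‖a‖ + ‖x - a‖) :=
      mul_le_mul_of_nonneg_left h3 (by positivity)
    have h7 := norm_nonneg c
    have h8 := norm_nonneg (((y - c : F) : H) + f (x - a : E))
    linarith
  have hx : x = 0 := by
    have : 0 < min 1 (ε : ℝ) := by positivity
    rw [← norm_le_zero_iff]
    nlinarith [norm_nonneg x]
  subst hx
  rw [amalgamSeminorm_right hf, norm_eq_zero] at hz
  rw [hz]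
  rfl

/-- An almost isometric map from a finite-dimensional subspace of a Gurarii space has an almost
isometric approximate inverse with arbitrarily small distortion. -/
theorem IsGurarii.exists_almost_inverse (hG : IsGurarii G) {E : Submodule ℝ G}
    [FiniteDimensional ℝ E] {f : G →ₗ[ℝ] H} {ε : ℝ} (hε : 0 < ε)
    (hf : IsAlmostIsometricOn ε E f) {F : Submodule ℝ H} [FiniteDimensional ℝ F]
    (hF : ∀ x ∈ E, f x ∈ F) {δ : ℝ} (hδ : 0 < δ) :
    ∃ k : H →ₗ[ℝ] G, IsAlmostIsometricOn δ F k ∧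
      ∀ x ∈ E, ‖k (f x) - x‖ ≤ (1 + δ) * ε * ‖x‖ := by
  lift ε to NNReal using hε.le
  have hε' : 0 < ε := by exact_mod_cast hε
  obtain ⟨Φ, h1, h2⟩ := hG.exists_extension_seminorm (amalgamSeminorm ε E F f)
    (amalgamSeminorm_definite hε' hf) (LinearMap.range (LinearMap.inl ℝ E F))
    (E.subtype.comp (LinearMap.fst ℝ E F)) (by
      rintro _ ⟨x, rfl⟩
      exact (amalgamSeminorm_left hf x).symm) hδ
  -- Off `F` the values of `k` are arbitrary; no continuity is claimed there.
  obtain ⟨k, hk⟩ := LinearMap.exists_extend (Φ.comp (LinearMap.inr ℝ E F))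
  have hk' : ∀ y : F, k y = Φ (0, y) := fun y => LinearMap.congr_fun hk y
  refine ⟨k, fun y hy => ?_, fun x hx => ?_⟩
  · have h3 := h2 (0, ⟨y, hy⟩)
    rw [amalgamSeminorm_right hf, ← hk'] at h3
    exact h3
  · have h3 : Φ (⟨x, hx⟩, 0) = x := h1 _ ⟨⟨x, hx⟩, rfl⟩
    have h4 : k (f x) = Φ (0, ⟨f x, hF x hx⟩) := hk' ⟨f x, hF x hx⟩
    -- The pair `(x, -f x)` has amalgam norm at most `ε * ‖x‖`, since the second seminorm loses its
    -- `f`-term there.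
    have h5 : k (f x) - x = -Φ (⟨x, hx⟩, -⟨f x, hF x hx⟩) := by
      conv_lhs => rw [h4]; arg 2; rw [← h3]
      rw [← map_sub, ← map_neg]
      simp
    rw [h5, norm_neg, mul_assoc]
    refine (h2 _).2.trans (mul_le_mul_of_nonneg_left ?_ (by positivity))
    refine (amalgamSeminorm_le_right ε E F f _ _).trans ?_
    simp

/-- One round of the back-and-forth construction. -/
theorem IsGurarii.back_and_forth (hG : IsGurarii G) (hH : IsGurarii H) {E : Submodule ℝ G}
    [FiniteDimensional ℝ E] {f : G →ₗ[ℝ] H} {ε : ℝ} (hε : 0 < ε) (hε' : ε ≤ 1)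
    (hf : IsAlmostIsometricOn ε E f) {η : ℝ} (hη : 0 < η) (hη' : η ≤ ε) (g : G) (h : H) :
    ∃ (E' : Submodule ℝ G) (f' : G →ₗ[ℝ] H), FiniteDimensional ℝ E' ∧
      IsAlmostIsometricOn η E' f' ∧ E ≤ E' ∧ g ∈ E' ∧
      (∀ x ∈ E, ‖f' x - f x‖ ≤ 8 * ε * ‖x‖) ∧
      ∃ e ∈ E', ‖e‖ ≤ 2 * ‖h‖ ∧ ‖f' e - h‖ ≤ 2 * η * ‖h‖ := by
  let F : Submodule ℝ H := E.map f ⊔ Submodule.span ℝ {h}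
  have hF : ∀ x ∈ E, f x ∈ F := fun x hx =>
    Submodule.mem_sup_left (Submodule.mem_map_of_mem hx)
  have hh : h ∈ F := Submodule.mem_sup_right (Submodule.mem_span_singleton_self h)
  obtain ⟨k, hk1, hk2⟩ := hG.exists_almost_inverse hε hf hF hη
  let E' : Submodule ℝ G := E ⊔ (F.map k ⊔ Submodule.span ℝ {g})
  have hE' : ∀ y ∈ F, k y ∈ E' := fun y hy =>
    Submodule.mem_sup_right (Submodule.mem_sup_left (Submodule.mem_map_of_mem hy))
  obtain ⟨f', hf1, hf2⟩ := hH.exists_almost_inverse hη hk1 hE' hη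
  have hle : E ≤ E' := le_sup_left
  have hf3 : ∀ y ∈ F, ‖f' (k y) - y‖ ≤ 2 * η * ‖y‖ := fun y hy =>
    (hf2 y hy).trans (by
      refine mul_le_mul_of_nonneg_right (mul_le_mul_of_nonneg_right ?_ hη.le) (norm_nonneg _)
      linarith)
  refine ⟨E', f', inferInstance, hf1, hle,
    Submodule.mem_sup_right (Submodule.mem_sup_right (Submodule.mem_span_singleton_self g)),
    fun x hx => ?_, k h, hE' h hh, ?_, hf3 h hh⟩
  · have h1 := (hf1 _ (E'.sub_mem (hE' _ (hF x hx)) (hle hx))).2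
    have h2 := hk2 x hx
    have h3 := hf3 _ (hF x hx)
    have h4 := (hf x hx).2
    -- Each of the two terms is at most `4 * ε * ‖x‖`, whence the constant 8.
    have h5 : ‖f' x - f x‖ ≤ ‖f' (k (f x)) - f x‖ + ‖f' (k (f x) - x)‖ := by
      refine le_trans (le_of_eq ?_) (norm_sub_le _ _)
      congr 1
      rw [map_sub]
      abel
    have hx0 := norm_nonneg x
    have h6 : (1 + η) * ‖k (f x) - x‖ ≤ 2 * (2 * ε * ‖x‖) := by
      refine mul_le_mul (by linarith) (h2.trans ?_) (norm_nonneg _) (by norm_num)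
      refine mul_le_mul_of_nonneg_right (mul_le_mul_of_nonneg_right ?_ hε.le) hx0
      linarith
    have h7 : 2 * η * ‖f x‖ ≤ 2 * ε * (2 * ‖x‖) := by
      refine mul_le_mul (by linarith) (h4.trans ?_) (norm_nonneg _) (by linarith)
      exact mul_le_mul_of_nonneg_right (by linarith) hx0
    linarith
  · exact (hk1 h hh).2.trans (mul_le_mul_of_nonneg_right (by linarith) (norm_nonneg _))

/-- A chain of almost isometric maps between two Gurarii spaces with distortions tending to zero,
passing through given sequences of vectors. -/
theorem IsGurarii.exists_chain (hG : IsGurarii G) (hH : IsGurarii H) (g : ℕ → G) (h : ℕ → H) :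
    ∃ (E : ℕ → Submodule ℝ G) (f : ℕ → G →ₗ[ℝ] H), Monotone E ∧
      ∀ n, IsAlmostIsometricOn ((1 / 2) ^ n) (E n) (f n) ∧ g n ∈ E (n + 1) ∧
        (∀ x ∈ E n, ‖f (n + 1) x - f n x‖ ≤ 8 * (1 / 2) ^ n * ‖x‖) ∧
        ∃ e ∈ E (n + 1), ‖e‖ ≤ 2 * ‖h n‖ ∧
          ‖f (n + 1) e - h n‖ ≤ 2 * (1 / 2) ^ (n + 1) * ‖h n‖ := by
  let P : ℕ → Submodule ℝ G × (G →ₗ[ℝ] H) → Prop := fun n s =>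
    FiniteDimensional ℝ s.1 ∧ IsAlmostIsometricOn ((1 / 2) ^ n) s.1 s.2
  have step : ∀ n (s : {s // P n s}), ∃ s' : {s // P (n + 1) s}, s.1.1 ≤ s'.1.1 ∧ g n ∈ s'.1.1 ∧
      (∀ x ∈ s.1.1, ‖s'.1.2 x - s.1.2 x‖ ≤ 8 * (1 / 2) ^ n * ‖x‖) ∧
        ∃ e ∈ s'.1.1, ‖e‖ ≤ 2 * ‖h n‖ ∧ ‖s'.1.2 e - h n‖ ≤ 2 * (1 / 2) ^ (n + 1) * ‖h n‖ := by
    rintro n ⟨⟨E, f⟩, hE, hf⟩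
    obtain ⟨E', f', h1, h2, h3⟩ := hG.back_and_forth hH (by positivity)
      (pow_le_one₀ (by norm_num) (by norm_num)) hf (η := (1 / 2) ^ (n + 1)) (by positivity)
      (pow_le_pow_of_le_one (by norm_num) (by norm_num) n.le_succ) (g n) (h n)
    exact ⟨⟨(E', f'), h1, h2⟩, h3⟩
  choose next hnext using step
  let s : ∀ n, {s // P n s} := fun n => Nat.rec
    ⟨(⊥, 0), inferInstanceAs (FiniteDimensional ℝ (⊥ : Submodule ℝ G)), fun x hx => by
      simp [(Submodule.mem_bot ℝ).1 hx]⟩ next n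
  exact ⟨fun n => (s n).1.1, fun n => (s n).1.2,
    monotone_nat_of_le_succ fun n => (hnext n (s n)).1,
    fun n => ⟨(s n).2.2, (hnext n (s n)).2⟩⟩

/-- Any two Gurarii spaces are linearly isometric. -/
theorem IsGurarii.nonempty_linearIsometryEquiv (hG : IsGurarii G) (hH : IsGurarii H) :
    Nonempty (G ≃ₗᵢ[ℝ] H) := by
  have := hG.complete
  have := hH.complete
  have := hG.separable
  have := hH.separable
  -- A vector of `H` is only approximated at its stage, so unpairing makes each one recur at
  -- arbitrarily late stages.
  obtain ⟨E, f, hE, hf⟩ := hG.exists_chain hH (TopologicalSpace.denseSeq G)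
    fun n => TopologicalSpace.denseSeq H n.unpair.1
  let D : Submodule ℝ G := ⨆ n, E n
  have hD : ∀ x, x ∈ D ↔ ∃ n, x ∈ E n := fun x =>
    Submodule.mem_iSup_of_directed E hE.directed_le
  have hlim : ∀ n, ∀ x ∈ E n, ∃ y, Tendsto (fun m => f m x) atTop (𝓝 y) ∧
      ‖f n x - y‖ ≤ 16 * (1 / 2) ^ n * ‖x‖ := by
    intro n x hx
    have hd : ∀ m, dist (f (m + n) x) (f (m + 1 + n) x) ≤
        8 * (1 / 2) ^ n * ‖x‖ * (1 / 2) ^ m := by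
      intro m
      have := (hf (m + n)).2.2.1 x (hE (Nat.le_add_left n m) hx)
      rw [dist_comm, dist_eq_norm, add_right_comm m 1 n]
      refine this.trans (le_of_eq ?_)
      rw [pow_add]
      ring
    obtain ⟨y, hy⟩ := cauchySeq_tendsto_of_complete
      (cauchySeq_of_le_geometric (1 / 2) _ (by norm_num) hd)
    refine ⟨y, (tendsto_add_atTop_iff_nat (f := fun m => f m x) n).1 hy, ?_⟩
    have h2 := dist_le_of_le_geometric_of_tendsto₀ (1 / 2) _ (by norm_num) hd hy
    rw [zero_add, dist_eq_norm] at h2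
    refine h2.trans (le_of_eq ?_)
    ring
  have hlimD : ∀ x : D, ∃ y, Tendsto (fun m => f m x) atTop (𝓝 y) := fun x => by
    obtain ⟨n, hn⟩ := (hD x).1 x.2
    obtain ⟨y, hy, -⟩ := hlim n x hn
    exact ⟨y, hy⟩
  choose L₀ hL₀ using hlimD
  let L : D →ₗ[ℝ] H := linearMapOfTendsto L₀ (fun m => (f m).comp D.subtype)
    (tendsto_pi_nhds.2 hL₀)
  have hL : ∀ x : D, Tendsto (fun m => f m x) atTop (𝓝 (L x)) := hL₀
  have hpow : Tendsto (fun m : ℕ => (1 / 2 : ℝ) ^ m) atTop (𝓝 0) :=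
    tendsto_pow_atTop_nhds_zero_of_lt_one (by norm_num) (by norm_num)
  have hLn : ∀ x : D, ‖L x‖ = ‖x‖ := by
    intro x
    obtain ⟨n, hn⟩ := (hD x).1 x.2
    have h1 : Tendsto (fun m : ℕ => (1 - (1 / 2 : ℝ) ^ m) * ‖x‖) atTop (𝓝 ‖x‖) := by
      simpa using (hpow.const_sub 1).mul_const ‖x‖
    have h2 : Tendsto (fun m : ℕ => (1 + (1 / 2 : ℝ) ^ m) * ‖x‖) atTop (𝓝 ‖x‖) := by
      simpa using (hpow.const_add 1).mul_const ‖x‖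
    refine tendsto_nhds_unique (hL x).norm (tendsto_of_tendsto_of_tendsto_of_le_of_le' h1 h2 ?_ ?_)
    · filter_upwards [eventually_ge_atTop n] with m hm
      exact ((hf m).1 x (hE hm hn)).1
    · filter_upwards [eventually_ge_atTop n] with m hm
      exact ((hf m).1 x (hE hm hn)).2
  have hinj : Function.Injective L := (injective_iff_map_eq_zero L).2 fun x hx => by
    rw [← norm_eq_zero, ← hLn, hx, norm_zero]
  have hdense₁ : DenseRange D.subtype := by
    refine (TopologicalSpace.denseRange_denseSeq G).mono ?_
    rintro _ ⟨n, rfl⟩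
    exact ⟨⟨_, (hD _).2 ⟨n + 1, (hf n).2.1⟩⟩, rfl⟩
  have hdense₂ : DenseRange (LinearMap.range L).subtype := by
    refine Metric.denseRange_iff.2 fun y r hr => ?_
    obtain ⟨m, hm⟩ := (TopologicalSpace.denseRange_denseSeq H).exists_dist_lt y (half_pos hr)
    set z := TopologicalSpace.denseSeq H m with hz
    -- Here 34 is 2 from approximating `z` at its stage plus 16 · 2 from passing to the limit at
    -- `e`, where `‖e‖ ≤ 2 * ‖z‖`.
    have h1 : Tendsto (fun n : ℕ => 34 * ‖z‖ * (1 / 2 : ℝ) ^ n) atTop (𝓝 0) := by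
      simpa using hpow.const_mul (34 * ‖z‖)
    obtain ⟨N, hN⟩ := eventually_atTop.1 (h1.eventually_lt_const (half_pos hr))
    have hN' := hN (Nat.pair m N + 1) ((Nat.right_le_pair m N).trans (Nat.le_succ _))
    obtain ⟨e, he, he1, he2⟩ := (hf (Nat.pair m N)).2.2.2
    simp only [Nat.unpair_pair, ← hz] at he1 he2
    obtain ⟨w, hw1, hw2⟩ := hlim _ e he
    let x : D := ⟨e, (hD e).2 ⟨_, he⟩⟩
    have hw : L x = w := tendsto_nhds_unique (hL x) hw1
    refine ⟨⟨L x, x, rfl⟩, ?_⟩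
    change dist y (L x) < r
    rw [hw]
    have h2 : dist z w ≤ 34 * ‖z‖ * (1 / 2 : ℝ) ^ (Nat.pair m N + 1) := by
      refine (dist_triangle_left z w (f (Nat.pair m N + 1) e)).trans ?_
      rw [dist_eq_norm, dist_eq_norm]
      have h3 : 16 * (1 / 2 : ℝ) ^ (Nat.pair m N + 1) * ‖e‖ ≤
          16 * (1 / 2 : ℝ) ^ (Nat.pair m N + 1) * (2 * ‖z‖) :=
        mul_le_mul_of_nonneg_left he1 (by positivity)
      linarith
    have h4 := dist_triangle y z w
    linarith
  exact ⟨(LinearEquiv.ofInjective L hinj).extendOfIsometry D.subtype (LinearMap.range L).subtype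
    hdense₁ hdense₂ fun x => hLn x⟩

end Uniqueness

end RationalGurarii

theorem mainTheorem6 {V : Type u} [NormedAddCommGroup V] [NormedSpace ℚ V]
    (hV : RationalGurarii.IsRationalGurarii V) :
    RationalGurarii.IsGurarii (UniformSpace.Completion V) ∧
      ∀ (G : Type v) [NormedAddCommGroup G] [NormedSpace ℝ G],
        RationalGurarii.IsGurarii G → Nonempty (UniformSpace.Completion V ≃ₗᵢ[ℝ] G) :=
  ⟨hV.isGurarii_completion, fun _ _ _ hG =>
    hV.isGurarii_completion.nonempty_linearIsometryEquiv hG⟩
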